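/- **Asymptotic MSE.** *Network.* Access points (APs) form a homogeneous Poisson process of density $\lambda>0$ on $\mathbb R^2$. The path loss of a link of length $d$ with shadowing $S>0$ is $S d^4$; shadowing is i.i.d. with $\mathbb E[S^{-1/2}]<\infty$, and each device is served by the AP of minimum path loss. Let $\rho_\lambda$ be the law of the serving path loss of the typical device, and $c_0$ its serving AP. The devices $X$ transmitting on the same resource block as the typical device are modelled as usual as a Poisson process of density $\lambda$ on $\mathbb R^2$, with independent marks, namely the shadowing $S_{X,c_0}$ (giving the path loss $L(X,c_0)$ to $c_0$), their own serving path loss $L_X\sim\rho_\lambda$ and a fading gain $H_X\sim\exp(1)$, restricted to the devices with $L_X\le L(X,c_0)$. With full path-loss-inversion power control and thermal noise neglected, $$\mathrm{SINR}_u=\frac{H_0}{\sum_X L_X H_X L(X,c_0)^{-1}},\qquad H_0\sim\exp(1)\text{ independent of the interferers.}$$ The load on the serving AP is taken to be its mean $\bar N_\lambda=1+1.28\,\lambda_u/\lambda$, where $\lambda_u>0$ is the device density. The uplink rate is $\mathrm{Rate}_u=\frac{b}{\bar N_\lambda}\log_2(1+\mathrm{SINR}_u)$, with bandwidth $b>0$,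 and the downlink rate $\mathrm{Rate}_d$ equals $\mathrm{Rate}_u$. *Inference.* The cloud inference delay is $D=\frac{q}{2\mathrm{Rate}_u}+\frac{q}{2\mathrm{Rate}_d}+\delta_c$, with payload $q>0$, compute delay $\delta_c\ge 0$ and delay budget $\delta_t>\delta_c$. The inference rate is $r_{\min}=\frac{q}{b(\delta_t-\delta_c)}$. Let $m_d=\mathbb E[(y-y_d)^2]$ and $m_c=\mathbb E[(y-y_c)^2]$ be the finite mean square errors of the edge output $y_d$ and the cloud output $y_c$, with $m_c\le m_d$. The average MSE is $\bar m(\lambda)=\mathbb E[\mathbf 1(D\le\delta_t)\,m_c]+\mathbb E[\mathbf 1(D>\delta_t)\,m_d]$. Put $C(x)=\sqrt x\arctan\sqrt x$ and $T(x)=2^x-1$. *Claim.* As $\lambda\to\infty$ (all other parameters fixed), $\bar N_\lambda\to1$, and $\bar m(\lambda)$ converges to a limit that depends on $q,b,\delta_c,\delta_t$ only through $r_{\min}$: $$m_{\mathrm{asy}}(r_{\min})=\lim_{\lambda\to\infty}\bar m(\lambda)=m_d-(m_d-m_c)\exp\bigl(-C(T(r_{\min}))\bigr).$$ The accuracy gain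 is limited by the inference rate: $m_d-\bar m(\lambda)\le (m_d-m_c)\exp(-C(T(r_{\min})))$ for every $\lambda>0$. If $m_c<m_d$, then $m_{\mathrm{asy}}$ is strictly increasing in $r_{\min}>0$, hence strictly decreasing in the bandwidth $b>0$ for fixed $q,\delta_c,\delta_t$. Moreover $m_{\mathrm{asy}}(r)\to m_d$ as $r\to\infty$, and $m_{\mathrm{asy}}(r)\to m_c$ as $r\downarrow0$. -/

import Mathlib

open MeasureTheory ProbabilityTheory Filter Topology Set
open scoped ENNReal

namespace DistInf

noncomputable section

/-! ### Poisson point processes -/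

/-- Number of points of the random set `Φ` that lie in `B`. -/
def pointCount {Ω E : Type*} (Φ : Ω → Set E) (B : Set E) (ω : Ω) : ℕ∞ := (Φ ω ∩ B).encard

/-- `Φ` is a (simple) Poisson point process with intensity measure `Λ` under `P`: a measurable
random countable set, with Poisson distributed counts, independent over disjoint sets. -/
structure IsPPP {Ω E : Type*} [MeasurableSpace Ω] [MeasurableSpace E]
    (P : Measure Ω) (Φ : Ω → Set E) (Λ : Measure E) : Prop where
  countable : ∀ ω, (Φ ω).Countable
  measurable_count : ∀ B, MeasurableSet B → Measurable (pointCount Φ B)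
  poisson : ∀ B, MeasurableSet B → Λ B ≠ ∞ → ∀ k : ℕ,
    P {ω | pointCount Φ B ω = (k : ℕ∞)} =
      ENNReal.ofReal (Real.exp (-(Λ B).toReal) * (Λ B).toReal ^ k / (k.factorial : ℝ))
  indep : ∀ (n : ℕ) (B : Fin n → Set E), (∀ i, MeasurableSet (B i)) →
    Pairwise (fun i j => Disjoint (B i) (B j)) → iIndepFun (fun i => pointCount Φ (B i)) P

/-- The σ-algebra on the sample space generated by a point process. -/
@[reducible] def sigmaOf {Ω E : Type*} [MeasurableSpace E] (Φ : Ω → Set E) : MeasurableSpace Ω :=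
  ⨆ B : {B : Set E // MeasurableSet B}, MeasurableSpace.comap (pointCount Φ B.1) inferInstance

/-! ### The uplink of the cellular network -/

/-- The plane with the Euclidean norm. -/
abbrev Plane : Type := EuclideanSpace ℝ (Fin 2)

/-- Path loss `s ‖x‖ ^ 4` over the displacement `x` with shadowing `s`. -/
def pathLoss (x : Plane) (s : ℝ) : ℝ≥0∞ := ENNReal.ofReal s * ‖x‖ₑ ^ 4

/-- Path loss between the device at the origin and its serving AP (minimum path loss association).
A point `(x, s)` of `Φ` is an AP at `x` together with the shadowing `s` on its link. -/
def servingPathLoss {Ω : Type*} (Φ : Ω → Set (Plane × ℝ)) (ω : Ω) : ℝ≥0∞ :=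
  ⨅ p ∈ Φ ω, pathLoss p.1 p.2

/-- A device that transmits on the resource block of the typical device. -/
abbrev Interferer : Type := Plane × ℝ × ℝ≥0∞ × ℝ

namespace Interferer

/-- Position relative to the AP that serves the typical device. -/
def pos (p : Interferer) : Plane := p.1

/-- Shadowing on the link to the AP that serves the typical device. -/
def shadow (p : Interferer) : ℝ := p.2.1

/-- Path loss between this device and its own serving AP. -/
def ownLoss (p : Interferer) : ℝ≥0∞ := p.2.2.1

/-- Fast fading gain on the link to the AP that serves the typical device. -/
def fading (p : Interferer) : ℝ := p.2.2.2

/-- Path loss of the link to the AP that serves the typical device. -/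
def crossLoss (p : Interferer) : ℝ≥0∞ := pathLoss p.pos p.shadow

end Interferer

/-- Intensity of the interferers: one device per cell, hence spatial density `lam`;
independent marks (shadowing `σ`, own serving path loss of law `ρ`, Rayleigh fading);
restricted to the devices which, by minimum path loss association, are not served by the AP of
the typical device, i.e. whose own serving path loss is at most the path loss to that AP. -/
def interfererIntensity (lam : ℝ) (σ : Measure ℝ) (ρ : Measure ℝ≥0∞) : Measure Interferer :=
  ((ENNReal.ofReal lam • (volume : Measure Plane)).prod (σ.prod (ρ.prod (expMeasure 1)))).restrict
    {p : Interferer | p.ownLoss ≤ p.crossLoss}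

/-- The shadowing has a law on `(0, ∞)` for which a minimum path loss exists
(`E[S ^ (-1/2)] < ∞`, i.e. a.s. finitely many APs have path loss below any level). -/
structure IsShadowingLaw (σ : Measure ℝ) : Prop where
  prob : IsProbabilityMeasure σ
  pos : ∀ᵐ s ∂σ, 0 < s
  moment : ∫⁻ s, ENNReal.ofReal (s ^ (-(1 / 2) : ℝ)) ∂σ ≠ ∞

/-- The uplink model with AP density `lam` and shadowing law `σ`:
`Φ` are the APs with their shadowing towards the typical device, `Ψ` the interferers,
`H` the fast fading between the typical device and its serving AP. The own serving path loss of
an interferer has the law of the serving path loss of the typical device. -/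
structure IsUplinkModel {Ω : Type*} [MeasurableSpace Ω] (P : Measure Ω) (lam : ℝ) (σ : Measure ℝ)
    (Φ : Ω → Set (Plane × ℝ)) (Ψ : Ω → Set Interferer) (H : Ω → ℝ) : Prop where
  aps : IsPPP P Φ ((ENNReal.ofReal lam • (volume : Measure Plane)).prod σ)
  interferers : IsPPP P Ψ (interfererIntensity lam σ (P.map (servingPathLoss Φ)))
  fading_measurable : Measurable H
  fading_law : P.map H = expMeasure 1
  fading_indep : Indep (MeasurableSpace.comap H inferInstance) (sigmaOf Ψ) P

/-- Received interference `∑ L_X H_X / L(X, c₀)` (full path loss inversion power control). -/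
def interference {Ω : Type*} (Ψ : Ω → Set Interferer) (ω : Ω) : ℝ≥0∞ :=
  ∑' p : Ψ ω, (p : Interferer).ownLoss * ENNReal.ofReal (p : Interferer).fading
    / (p : Interferer).crossLoss

/-- Uplink SINR of the typical device; `snrInv` is `1 / SNR`. -/
def sinr {Ω : Type*} (snrInv : ℝ≥0∞) (Ψ : Ω → Set Interferer) (H : Ω → ℝ) (ω : Ω) : ℝ≥0∞ :=
  ENNReal.ofReal (H ω) / (snrInv + interference Ψ ω)

/-- `log₂ (1 + x)` for `x ∈ [0, ∞]`. -/
def log2OneAdd (x : ℝ≥0∞) : ℝ≥0∞ := (ENNReal.log (1 + x)).toENNReal / ENNReal.ofReal (Real.log 2)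

/-- Rate `(b / load) log₂ (1 + SINR)`. -/
def rate (b load : ℝ) (x : ℝ≥0∞) : ℝ≥0∞ := ENNReal.ofReal (b / load) * log2OneAdd x

/-- Mean load `1 + 1.28 / (lam / lamU)` on the AP serving the typical device. -/
def averageLoad (lamU lam : ℝ) : ℝ := 1 + 1.28 / (lam / lamU)

/-! ### Distributed inference -/

/-- Cloud inference delay for payload `q / 2` in each direction and compute delay `δc`. -/
def delay (q δc : ℝ) (rateU rateD : ℝ≥0∞) : ℝ≥0∞ :=
  ENNReal.ofReal q / (2 * rateU) + ENNReal.ofReal q / (2 * rateD) + ENNReal.ofReal δc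

/-- Inference rate `r_min`. -/
def inferenceRate (q b δt δc : ℝ) : ℝ := q / (b * (δt - δc))

/-- Mean square error of the inference output `Yhat` for the true output `Y`. -/
def mse {𝒳 : Type*} [MeasurableSpace 𝒳] (ν : Measure 𝒳) (Y Yhat : 𝒳 → ℝ) : ℝ :=
  ∫ x, (Y x - Yhat x) ^ 2 ∂ν

/-- Cloud inference delay of the typical device: the downlink rate equals the uplink rate,
and the load is constant. -/
def cloudDelay {Ω : Type*} (snrInv : ℝ≥0∞) (q b δc load : ℝ) (Ψ : Ω → Set Interferer)
    (H : Ω → ℝ) (ω : Ω) : ℝ≥0∞ :=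
  delay q δc (rate b load (sinr snrInv Ψ H ω)) (rate b load (sinr snrInv Ψ H ω))

/-- Average MSE `E[1(D ≤ δt) m_c] + E[1(D > δt) m_d]` for the cloud inference delay `D`. -/
def averageMSE {Ω : Type*} [MeasurableSpace Ω] (P : Measure Ω) (D : Ω → ℝ≥0∞)
    (δt mc md : ℝ) : ℝ :=
  (∫ ω, {ω | D ω ≤ ENNReal.ofReal δt}.indicator (fun _ => mc) ω ∂P) +
    ∫ ω, {ω | ENNReal.ofReal δt < D ω}.indicator (fun _ => md) ω ∂P

/-- `C(x) = √x arctan √x`. -/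
def funC (x : ℝ) : ℝ := √x * Real.arctan (√x)

/-- `T(x) = 2 ^ x - 1`. -/
def funT (x : ℝ) : ℝ := (2 : ℝ) ^ x - 1

end

end DistInf

namespace DistInf

/-! The law of the noiseless SINR does not depend on the density: `P(SINR ≥ T) = exp (-C(T))` for
every `λ > 0` (`IsUplinkModel.measure_le_sinr`). Density enters the delay only through the mean
load, which decreases to 1.

In the coordinate `W = √S ‖x‖²`, the square root of a path loss, the APs have constant intensity `κ
= λ π E[S^(-1/2)]` on the half-line (`map_rootLoss_apIntensity`). Void probabilities then make the
root serving loss `V` exponential of rate `κ` (`IsPPP.map_rootLoss_servingPathLoss`). Interferers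
have the same constant intensity in `W`, with an independent mark `V` and the restriction `V ≤ W`.

Since `H₀` is exponential, `P(SINR ≥ T) = E[exp (-T I)]`, with `I` the interference. The Laplace
functional of a Poisson process (`IsPPP.lintegral_negExp_tsum`) turns this into `exp (-κ E[∫_V^∞ T
V² / (W² + T V²) dW])`. The inner integral is `C(T) V` (`lintegral_interfererEffect`), and `κ E[V] =
1` removes `κ` (`lintegral_interfererIntensity`).

Finally `D ≤ δt` means `SINR ≥ T(N r_min)` for load `N` (`delay_le_iff`), so the average MSE is
explicit at each density; the limit, bound and monotonicity follow from those of `C` and `T`. -/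

/-- The function `x ↦ exp (-x)` on `[0, ∞]`. -/
noncomputable def negExp (x : ℝ≥0∞) : ℝ≥0∞ := EReal.exp (-(x : EReal))

lemma negExp_zero : negExp 0 = 1 := by simp [negExp]

lemma negExp_top : negExp ∞ = 0 := by simp [negExp]

lemma negExp_ofReal {x : ℝ} (hx : 0 ≤ x) :
    negExp (ENNReal.ofReal x) = ENNReal.ofReal (Real.exp (-x)) := by
  rw [negExp, EReal.coe_ennreal_ofReal, max_eq_left hx, ← EReal.coe_neg, EReal.exp_coe]

lemma negExp_add (x y : ℝ≥0∞) : negExp (x + y) = negExp x * negExp y := by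
  rw [negExp, negExp, negExp, ← EReal.exp_add, EReal.coe_ennreal_add, EReal.neg_add,
    sub_eq_add_neg] <;> simp

lemma negExp_nsmul (n : ℕ) (x : ℝ≥0∞) : negExp (n * x) = negExp x ^ n := by
  induction n with
  | zero => simp [negExp_zero]
  | succ n ih => rw [Nat.cast_succ, add_mul, one_mul, negExp_add, ih, pow_succ]

lemma negExp_sum {ι : Type*} (s : Finset ι) (f : ι → ℝ≥0∞) :
    negExp (∑ i ∈ s, f i) = ∏ i ∈ s, negExp (f i) := by
  classical
  induction s using Finset.induction_on with
  | empty => simp [negExp_zero]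
  | insert i s hi ih => rw [Finset.sum_insert hi, Finset.prod_insert hi, negExp_add, ih]

lemma continuous_negExp : Continuous negExp := by
  exact ENNReal.continuous_exp.comp (continuous_neg.comp continuous_coe_ennreal_ereal)

lemma measurable_negExp : Measurable negExp := continuous_negExp.measurable

lemma negExp_antitone : Antitone negExp := fun x y h => by
  unfold negExp
  simpa using h

lemma negExp_le_one (x : ℝ≥0∞) : negExp x ≤ 1 := by
  rw [← negExp_zero]; exact negExp_antitone zero_le

lemma negExp_ne_top (x : ℝ≥0∞) : negExp x ≠ ∞ := ((negExp_le_one x).trans_lt ENNReal.one_lt_top).ne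

/-- Monotone convergence for counting measure on `A`, where the discrete σ-algebra makes every
function measurable. -/
lemma tendsto_tsum_of_monotone {E : Type*} {A : Set E} {g : ℕ → E → ℝ≥0∞} {f : E → ℝ≥0∞}
    (hm : Monotone g) (hg : ∀ x, Tendsto (fun n => g n x) atTop (𝓝 (f x))) :
    Tendsto (fun n => ∑' p : A, g n p) atTop (𝓝 (∑' p : A, f p)) := by
  let _ : MeasurableSpace A := ⊤
  have h (u : E → ℝ≥0∞) : ∑' p : A, u p = ∫⁻ p : A, u p ∂Measure.count :=
    (lintegral_count' measurable_from_top).symm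
  simp_rw [h]
  exact lintegral_tendsto_of_tendsto_of_monotone (fun n => measurable_from_top.aemeasurable)
    (ae_of_all _ fun p _ _ hnm => hm hnm p) (ae_of_all _ fun p => hg p)

/-! ### Laplace functional of a Poisson process -/

section PointProcess

variable {Ω E : Type*} [MeasurableSpace E]

/-- Grouping the points by the value of `g` reduces a sum over the process to finitely many counts.
-/
lemma tsum_simpleFunc (A : Set E) (g : SimpleFunc E ℝ≥0∞) :
    ∑' p : A, g p = ∑ c ∈ g.range, c * ((A ∩ g ⁻¹' {c}).encard : ℝ≥0∞) := by
  classical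
  have h1 : ∀ p : A, g p = ∑ c ∈ g.range, c * (g ⁻¹' {c}).indicator 1 (p : E) := by
    intro p
    rw [Finset.sum_eq_single (g p)]
    · simp
    · intro b _ hb
      simp [hb.symm]
    · intro h
      exact absurd (g.mem_range_self p) h
  rw [tsum_congr h1, Summable.tsum_finsetSum (fun _ _ => ENNReal.summable)]
  refine Finset.sum_congr rfl fun c _ => ?_
  rw [ENNReal.tsum_mul_left, ← ENNReal.tsum_set_one, tsum_subtype A,
    tsum_subtype (A ∩ g ⁻¹' {c}) (fun _ => (1 : ℝ≥0∞)), Set.indicator_indicator]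
  rfl

/-- Stated for `sigmaOf Φ` rather than the ambient σ-algebra because independence of the fading is
assumed relative to `sigmaOf Ψ`. -/
lemma measurable_tsum_sigmaOf (Φ : Ω → Set E) {f : E → ℝ≥0∞} (hf : Measurable f) :
    Measurable[sigmaOf Φ] (fun ω => ∑' p : Φ ω, f p) := by
  have key (g : SimpleFunc E ℝ≥0∞) : Measurable[sigmaOf Φ] (fun ω => ∑' p : Φ ω, g p) := by
    simp_rw [tsum_simpleFunc]
    let _ : MeasurableSpace Ω := sigmaOf Φ
    refine Finset.measurable_sum _ fun c _ => ?_
    have : Measurable (pointCount Φ (g ⁻¹' {c})) :=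
      measurable_iff_comap_le.2 (le_iSup (fun B : {B : Set E // MeasurableSet B} =>
        MeasurableSpace.comap (pointCount Φ B.1) inferInstance)
        ⟨g ⁻¹' {c}, g.measurableSet_preimage _⟩)
    exact ((measurable_from_top (f := fun n : ℕ∞ => (n : ℝ≥0∞))).comp this).const_mul c
  let _ : MeasurableSpace Ω := sigmaOf Φ
  refine measurable_of_tendsto_metrizable (fun n => key (SimpleFunc.eapprox f n))
    (tendsto_pi_nhds.2 fun ω => ?_)
  exact tendsto_tsum_of_monotone (fun _ _ h => SimpleFunc.monotone_eapprox f h)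
    (fun x => SimpleFunc.tendsto_eapprox hf x)

variable [MeasurableSpace Ω] {P : Measure Ω} {Φ : Ω → Set E} {Λ : Measure E}

lemma IsPPP.sigmaOf_le (h : IsPPP P Φ Λ) : sigmaOf Φ ≤ ‹MeasurableSpace Ω› :=
  iSup_le fun B => measurable_iff_comap_le.1 (h.measurable_count B.1 B.2)

lemma IsPPP.indep_fintype (h : IsPPP P Φ Λ) {ι : Type*} [Fintype ι] (B : ι → Set E)
    (hB : ∀ i, MeasurableSet (B i)) (hd : Pairwise (fun i j => Disjoint (B i) (B j))) :
    iIndepFun (fun i => pointCount Φ (B i)) P := by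
  let e := Fintype.equivFin ι
  have := (h.indep _ (B ∘ e.symm) (fun i => hB _)
    (fun i j hij => hd (e.symm.injective.ne hij))).precomp e.injective
  simpa [Function.comp_def] using this

/-- Laplace transform of a Poisson count. -/
lemma IsPPP.lintegral_negExp_count (h : IsPPP P Φ Λ) {B : Set E} (hB : MeasurableSet B)
    (hfin : Λ B ≠ ∞) {c : ℝ≥0∞} (hc : c ≠ 0) :
    ∫⁻ ω, negExp (c * (pointCount Φ B ω : ℝ≥0∞)) ∂P = negExp ((1 - negExp c) * Λ B) := by
  have hm := h.measurable_count B hB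
  set F : ℕ∞ → ℝ≥0∞ := fun n => negExp (c * (n : ℝ≥0∞)) with hF
  have h1 : ∫⁻ ω, F (pointCount Φ B ω) ∂P = ∫⁻ n, F n ∂(P.map (pointCount Φ B)) :=
    (lintegral_map measurable_from_top hm).symm
  rw [show (∫⁻ ω, negExp (c * (pointCount Φ B ω : ℝ≥0∞)) ∂P) = _ from h1, lintegral_countable',
    ← (Nat.cast_injective (R := ℕ∞)).tsum_eq]
  · set m := (Λ B).toReal with hmdef
    have hm0 : 0 ≤ m := ENNReal.toReal_nonneg
    set z := (negExp c).toReal with hz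
    have hz0 : 0 ≤ z := ENNReal.toReal_nonneg
    have hzc : negExp c = ENNReal.ofReal z := (ENNReal.ofReal_toReal (negExp_ne_top c)).symm
    have hz1 : z ≤ 1 := ENNReal.toReal_le_of_le_ofReal zero_le_one (by simpa using negExp_le_one c)
    have hterm (k : ℕ) : F (k : ℕ∞) * P.map (pointCount Φ B) {(k : ℕ∞)}
        = ENNReal.ofReal (Real.exp (-m) * ((m * z) ^ k / (k.factorial : ℝ))) := by
      rw [Measure.map_apply hm (measurableSet_singleton _)]
      have := h.poisson B hB hfin k
      rw [show pointCount Φ B ⁻¹' {(k : ℕ∞)} = {ω | pointCount Φ B ω = (k : ℕ∞)} from rfl, this]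
      simp only [hF, ENat.toENNReal_coe]
      rw [mul_comm c, negExp_nsmul, hzc, ← ENNReal.ofReal_pow hz0, ← ENNReal.ofReal_mul (by positivity)]
      congr 1
      rw [mul_pow]; ring
    have hs := (NormedSpace.expSeries_div_hasSum_exp (m * z)).mul_left (Real.exp (-m))
    rw [tsum_congr hterm, ← ENNReal.ofReal_tsum_of_nonneg (fun k => by positivity) hs.summable,
      hs.tsum_eq, ← Real.exp_eq_exp_ℝ, ← Real.exp_add, hzc, ← ENNReal.ofReal_one,
      ← ENNReal.ofReal_sub _ hz0, ← ENNReal.ofReal_toReal hfin, ← hmdef,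
      ← ENNReal.ofReal_mul (by linarith), negExp_ofReal (mul_nonneg (by linarith) hm0)]
    congr 2; ring
  -- An infinite count contributes nothing, since `c ≠ 0` gives `exp (-(c * ∞)) = 0`; the sum may be
  -- taken over the naturals.
  · intro n hn
    induction n with
    | top => exact absurd (by simp [hF, hc, negExp_top]) hn
    | coe k => exact ⟨k, rfl⟩

/-- Level sets are disjoint, so their counts are independent and the expectation factors. The zero
level may have infinite intensity but gives the factor 1. -/
lemma IsPPP.lintegral_negExp_simpleFunc (h : IsPPP P Φ Λ) [IsProbabilityMeasure P]
    (g : SimpleFunc E ℝ≥0∞)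
    (hg : ∀ c, c ≠ 0 → Λ (g ⁻¹' {c}) ≠ ∞) :
    ∫⁻ ω, negExp (∑' p : Φ ω, g p) ∂P = negExp (∫⁻ p, (1 - negExp (g p)) ∂Λ) := by
  have hi : iIndepFun (fun c : g.range => pointCount Φ (g ⁻¹' {(c : ℝ≥0∞)})) P :=
    h.indep_fintype _ (fun c => g.measurableSet_preimage _) (fun c d hcd =>
      Disjoint.preimage _ (disjoint_singleton.2 fun hcd' => hcd (Subtype.ext hcd')))
  have hi' := hi.comp (fun c n => negExp ((c : ℝ≥0∞) * (n : ℝ≥0∞))) (fun _ => measurable_from_top)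
  have hmeas (c : g.range) : Measurable (fun ω => negExp ((c : ℝ≥0∞) *
      (pointCount Φ (g ⁻¹' {(c : ℝ≥0∞)}) ω : ℝ≥0∞))) :=
    (measurable_from_top (f := fun n : ℕ∞ => negExp ((c : ℝ≥0∞) * (n : ℝ≥0∞)))).comp
      (h.measurable_count _ (g.measurableSet_preimage _))
  have hL : ∀ ω, negExp (∑' p : Φ ω, g p) = ∏ c : g.range, negExp ((c : ℝ≥0∞) *
      (pointCount Φ (g ⁻¹' {(c : ℝ≥0∞)}) ω : ℝ≥0∞)) := by
    intro ω
    rw [tsum_simpleFunc, negExp_sum, ← Finset.prod_coe_sort]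
    rfl
  have hR : ∫⁻ p, (1 - negExp (g p)) ∂Λ = ∑ c ∈ g.range, (1 - negExp c) * Λ (g ⁻¹' {c}) :=
    ((g.map (fun c => 1 - negExp c)).lintegral_eq_lintegral Λ).trans (g.map_lintegral _)
  rw [lintegral_congr hL, hR, negExp_sum, ← Finset.prod_coe_sort]
  refine (lintegral_prod_eq_prod_lintegral_of_indepFun _ _ hi' hmeas).trans ?_
  refine Finset.prod_congr rfl fun c _ => ?_
  by_cases hc : (c : ℝ≥0∞) = 0
  · simp [hc, negExp_zero]
  · exact h.lintegral_negExp_count (g.measurableSet_preimage _) (hg _ hc) hc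

/-- Laplace functional of a Poisson point process. -/
theorem IsPPP.lintegral_negExp_tsum (h : IsPPP P Φ Λ) [IsProbabilityMeasure P] [SigmaFinite Λ]
    {f : E → ℝ≥0∞} (hf : Measurable f) :
    ∫⁻ ω, negExp (∑' p : Φ ω, f p) ∂P = negExp (∫⁻ p, (1 - negExp (f p)) ∂Λ) := by
  -- Truncation to spanning sets gives every nonzero level set finite intensity.
  let g : ℕ → SimpleFunc E ℝ≥0∞ := fun n => (SimpleFunc.eapprox f n).restrict (spanningSets Λ n)
  have hgx (n : ℕ) (x : E) :
      g n x = (spanningSets Λ n).indicator (SimpleFunc.eapprox f n) x :=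
    SimpleFunc.restrict_apply _ (measurableSet_spanningSets Λ n) x
  have hmono : Monotone (fun n x => g n x) := by
    intro n m hnm x
    simp only [hgx]
    by_cases hx : x ∈ spanningSets Λ n
    · rw [indicator_of_mem hx, indicator_of_mem (monotone_spanningSets Λ hnm hx)]
      exact SimpleFunc.monotone_eapprox f hnm x
    · simp [hx]
  have hlim (x : E) : Tendsto (fun n => g n x) atTop (𝓝 (f x)) := by
    refine (SimpleFunc.tendsto_eapprox hf x).congr' ?_
    filter_upwards [eventually_ge_atTop (spanningSetsIndex Λ x)] with n hn
    rw [hgx, indicator_of_mem (mem_spanningSets_of_index_le Λ x hn)]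
  have hfin (n : ℕ) : ∀ c, c ≠ 0 → Λ (g n ⁻¹' {c}) ≠ ∞ := by
    intro c hc
    refine ((measure_mono ?_).trans_lt (measure_spanningSets_lt_top Λ n)).ne
    intro x hx
    by_contra hxn
    rw [mem_preimage, mem_singleton_iff, hgx, indicator_of_notMem hxn] at hx
    exact hc hx.symm
  have h1 : Tendsto (fun n => ∫⁻ ω, negExp (∑' p : Φ ω, g n p) ∂P) atTop
      (𝓝 (∫⁻ ω, negExp (∑' p : Φ ω, f p) ∂P)) := by
    refine tendsto_lintegral_of_dominated_convergence (fun _ => 1) (fun n => ?_) (fun n => ?_)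
      (by simp) (ae_of_all _ fun ω => ?_)
    · exact measurable_negExp.comp
        ((measurable_tsum_sigmaOf Φ (g n).measurable).mono h.sigmaOf_le le_rfl)
    · exact ae_of_all _ fun ω => negExp_le_one _
    · exact (continuous_negExp.tendsto _).comp (tendsto_tsum_of_monotone hmono hlim)
  have h2 : Tendsto (fun n => ∫⁻ p, (1 - negExp (g n p)) ∂Λ) atTop
      (𝓝 (∫⁻ p, (1 - negExp (f p)) ∂Λ)) := by
    refine lintegral_tendsto_of_tendsto_of_monotone
      (fun n => ((measurable_negExp.comp (g n).measurable).const_sub 1).aemeasurable)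
      (ae_of_all _ fun p n m hnm => tsub_le_tsub_left (negExp_antitone (hmono hnm p)) 1)
      (ae_of_all _ fun p => ?_)
    exact ENNReal.Tendsto.sub tendsto_const_nhds ((continuous_negExp.tendsto _).comp (hlim p))
      (Or.inl ENNReal.one_ne_top)
  refine tendsto_nhds_unique h1 ?_
  simp_rw [h.lintegral_negExp_simpleFunc _ (hfin _)]
  exact (continuous_negExp.tendsto _).comp h2

end PointProcess

/-! ### Exponential laws -/

lemma expMeasure_Ici {κ t : ℝ} (hκ : 0 < κ) (ht : 0 ≤ t) :
    expMeasure κ (Ici t) = ENNReal.ofReal (Real.exp (-(κ * t))) := by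
  have := isProbabilityMeasure_expMeasure hκ
  have hac : expMeasure κ ≪ volume := withDensity_absolutelyContinuous _ _
  rw [measure_congr (hac.ae_eq (Ioi_ae_eq_Ici (a := t))).symm, ← compl_Iic,
    prob_compl_eq_one_sub measurableSet_Iic, ← ofReal_cdf, cdf_expMeasure_eq hκ, if_pos ht,
    ← ENNReal.ofReal_one, ← ENNReal.ofReal_sub]
  · congr 1; ring
  · simp only [sub_nonneg, Real.exp_le_one_iff, Left.neg_nonpos_iff]; positivity

lemma ae_pos_expMeasure {κ : ℝ} (hκ : 0 < κ) : ∀ᵐ x ∂expMeasure κ, 0 < x := by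
  have := isProbabilityMeasure_expMeasure hκ
  have h : expMeasure κ (Iic 0) = 0 := by
    rw [← ofReal_cdf, cdf_expMeasure_eq hκ]; simp
  rw [ae_iff]
  simpa [Iic] using h

lemma lintegral_expMeasure (κ : ℝ) (f : ℝ → ℝ≥0∞) (hf : Measurable f) :
    ∫⁻ x, f x ∂expMeasure κ =
      ∫⁻ x in Ici 0, ENNReal.ofReal (κ * Real.exp (-(κ * x))) * f x := by
  have h : Measurable (exponentialPDF κ) := (measurable_exponentialPDFReal κ).ennreal_ofReal
  rw [show expMeasure κ = volume.withDensity (exponentialPDF κ) from rfl,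
    lintegral_withDensity_eq_lintegral_mul _ h hf, ← lintegral_indicator measurableSet_Ici]
  refine lintegral_congr fun x => ?_
  by_cases hx : 0 ≤ x
  · simp [exponentialPDF_of_nonneg hx, hx]
  · simp [exponentialPDF_of_neg (not_le.1 hx), hx]

lemma lintegral_id_expMeasure {κ : ℝ} (hκ : 0 < κ) :
    ∫⁻ x, ENNReal.ofReal x ∂expMeasure κ = ENNReal.ofReal κ⁻¹ := by
  -- `x * κ e^(-κ x)` is `κ⁻¹` times the Gamma density of shape 2 and rate `κ`.
  have h := lintegral_gammaPDF_eq_one (a := 2) two_pos hκ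
  rw [lintegral_expMeasure κ _ ENNReal.measurable_ofReal, ← mul_one (ENNReal.ofReal κ⁻¹), ← h,
    ← lintegral_const_mul' _ _ ENNReal.ofReal_ne_top, ← lintegral_indicator measurableSet_Ici]
  refine lintegral_congr fun x => ?_
  by_cases hx : 0 ≤ x
  · rw [indicator_of_mem (mem_Ici.2 hx), gammaPDF_of_nonneg hx, ← ENNReal.ofReal_mul (by positivity),
      ← ENNReal.ofReal_mul (by positivity)]
    congr 1
    have : Real.Gamma 2 = 1 := Real.Gamma_two
    rw [this]
    norm_num
    field_simp
  · rw [indicator_of_notMem (by simpa using hx), gammaPDF_of_neg (not_le.1 hx), mul_zero]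

/-- Tilting the rate 1 density by `e^(-c x)` gives `(1 + c)⁻¹` times the density of rate `1 + c`. -/
lemma lintegral_negExp_expMeasure {c : ℝ} (hc : 0 ≤ c) :
    ∫⁻ x, negExp (ENNReal.ofReal (c * x)) ∂expMeasure 1 = ENNReal.ofReal (1 + c)⁻¹ := by
  have h := lintegral_exponentialPDF_eq_one (r := 1 + c) (by linarith)
  have hm : Measurable fun x : ℝ => negExp (ENNReal.ofReal (c * x)) :=
    measurable_negExp.comp (by fun_prop)
  rw [lintegral_expMeasure 1 _ hm,
    ← mul_one (ENNReal.ofReal (1 + c)⁻¹), ← h,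
    ← lintegral_const_mul' _ _ ENNReal.ofReal_ne_top, ← lintegral_indicator measurableSet_Ici]
  refine lintegral_congr fun x => ?_
  by_cases hx : 0 ≤ x
  · rw [indicator_of_mem (mem_Ici.2 hx), exponentialPDF_of_nonneg hx, negExp_ofReal (by positivity),
      ← ENNReal.ofReal_mul (by positivity), ← ENNReal.ofReal_mul (by positivity), one_mul, one_mul,
      ← Real.exp_add, inv_mul_cancel_left₀ (by positivity)]
    congr 2; ring
  · rw [indicator_of_notMem (by simpa using hx), exponentialPDF_of_neg (not_le.1 hx), mul_zero]

lemma lintegral_one_sub_negExp_expMeasure {c : ℝ} (hc : 0 ≤ c) :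
    ∫⁻ x, (1 - negExp (ENNReal.ofReal (c * x))) ∂expMeasure 1 = ENNReal.ofReal (c / (1 + c)) := by
  have := isProbabilityMeasure_expMeasure one_pos
  have hm : Measurable fun x : ℝ => negExp (ENNReal.ofReal (c * x)) :=
    measurable_negExp.comp (by fun_prop)
  rw [lintegral_sub hm (by rw [lintegral_negExp_expMeasure hc]; exact ENNReal.ofReal_ne_top)
    (ae_of_all _ fun x => negExp_le_one _), lintegral_negExp_expMeasure hc, lintegral_one,
    measure_univ, ← ENNReal.ofReal_one, ← ENNReal.ofReal_sub _ (by positivity)]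
  congr 1
  field_simp
  ring

/-! ### Square roots of path losses -/

/-- Square root of a path loss, as a real number. -/
noncomputable def rootLoss (l : ℝ≥0∞) : ℝ := √l.toReal

lemma measurable_rootLoss : Measurable rootLoss := by
  unfold rootLoss; fun_prop

/-- As `toReal` sends `∞` to 0, a positive root excludes both `l = 0` and `l = ∞`. -/
lemma eq_ofReal_rootLoss_sq {l : ℝ≥0∞} (h : 0 < rootLoss l) :
    l = ENNReal.ofReal (rootLoss l ^ 2) := by
  have h1 : 0 < l.toReal := Real.sqrt_pos.1 h
  rw [rootLoss, Real.sq_sqrt h1.le, ENNReal.ofReal_toReal]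
  rintro rfl
  simp at h1

lemma le_iff_rootLoss_le {l m : ℝ≥0∞} (hl : 0 < rootLoss l) (hm : 0 < rootLoss m) :
    l ≤ m ↔ rootLoss l ≤ rootLoss m := by
  conv_lhs => rw [eq_ofReal_rootLoss_sq hl, eq_ofReal_rootLoss_sq hm]
  rw [ENNReal.ofReal_le_ofReal_iff (by positivity), sq_le_sq₀ hl.le hm.le]

lemma measurable_pathLoss : Measurable (fun p : Plane × ℝ => pathLoss p.1 p.2) := by
  unfold pathLoss; fun_prop

lemma pathLoss_ne_top (x : Plane) (s : ℝ) : pathLoss x s ≠ ∞ := by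
  unfold pathLoss; finiteness

lemma rootLoss_pathLoss (x : Plane) {s : ℝ} (hs : 0 ≤ s) :
    rootLoss (pathLoss x s) = √s * ‖x‖ ^ 2 := by
  rw [rootLoss, pathLoss, ENNReal.toReal_mul, ENNReal.toReal_ofReal hs, ENNReal.toReal_pow,
    toReal_enorm, Real.sqrt_mul hs, show ‖x‖ ^ 4 = (‖x‖ ^ 2) ^ 2 by ring,
    Real.sqrt_sq (by positivity)]

/-- Rate of the Poisson process of the square roots of the path losses to the access points. -/
noncomputable def rootLossRate (lam : ℝ) (σ : Measure ℝ) : ℝ :=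
  lam * Real.pi * (∫⁻ s, ENNReal.ofReal (s ^ (-(1 / 2) : ℝ)) ∂σ).toReal

lemma rootLossRate_pos {lam : ℝ} (hlam : 0 < lam) {σ : Measure ℝ} (hσ : IsShadowingLaw σ) :
    0 < rootLossRate lam σ := by
  have := hσ.prob
  refine mul_pos (by positivity) (ENNReal.toReal_pos (fun h => ?_) hσ.moment)
  rw [lintegral_eq_zero_iff (by fun_prop)] at h
  obtain ⟨s, hs, hs0⟩ := (h.and hσ.pos).exists
  simp only [Pi.zero_apply, ENNReal.ofReal_eq_zero] at hs
  exact absurd (Real.rpow_pos_of_pos hs0 _) (not_lt.2 hs)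

/-- Intensity of the access points together with their shadowing. -/
noncomputable abbrev apIntensity (lam : ℝ) (σ : Measure ℝ) : Measure (Plane × ℝ) :=
  (ENNReal.ofReal lam • (volume : Measure Plane)).prod σ

/-- For fixed shadowing `s` the set is a disc of area `π t / √s`, linear in `t`; this is what the
exponent 4 and the square root achieve together. For `t ≤ 0` the disc is empty. -/
lemma apIntensity_rootLoss_lt {lam : ℝ} (hlam : 0 < lam) {σ : Measure ℝ} (hσ : IsShadowingLaw σ)
    (t : ℝ) :
    apIntensity lam σ {p | rootLoss (pathLoss p.1 p.2) < t} =
      ENNReal.ofReal (rootLossRate lam σ) * ENNReal.ofReal t := by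
  have := hσ.prob
  have hm : MeasurableSet {p : Plane × ℝ | rootLoss (pathLoss p.1 p.2) < t} :=
    measurableSet_lt (measurable_rootLoss.comp measurable_pathLoss) measurable_const
  rw [Measure.prod_apply_symm hm]
  have hs : ∀ᵐ s ∂σ, (ENNReal.ofReal lam • (volume : Measure Plane))
      ((fun x => (x, s)) ⁻¹' {p | rootLoss (pathLoss p.1 p.2) < t}) =
      (ENNReal.ofReal lam * ENNReal.ofReal Real.pi * ENNReal.ofReal t) *
        ENNReal.ofReal (s ^ (-(1 / 2) : ℝ)) := by
    filter_upwards [hσ.pos] with s hs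
    have hset : (fun x : Plane => (x, s)) ⁻¹' {p | rootLoss (pathLoss p.1 p.2) < t} =
        Metric.ball 0 (√(t / √s)) := by
      ext x
      simp only [mem_preimage, mem_ofPred_eq, rootLoss_pathLoss x hs.le, mem_ball_zero_iff]
      rw [Real.lt_sqrt (norm_nonneg x), lt_div_iff₀' (Real.sqrt_pos.2 hs)]
    rw [hset, Measure.smul_apply, EuclideanSpace.volume_ball_fin_two, smul_eq_mul]
    have : ENNReal.ofReal (√(t / √s)) ^ 2 = ENNReal.ofReal t * ENNReal.ofReal (s ^ (-(1 / 2) : ℝ)) := by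
      rw [Real.rpow_neg hs.le, ← Real.sqrt_eq_rpow, ← ENNReal.ofReal_pow (by positivity)]
      rcases le_total 0 t with ht | ht
      · rw [Real.sq_sqrt (by positivity), ← ENNReal.ofReal_mul ht, div_eq_mul_inv]
      · rw [Real.sqrt_eq_zero_of_nonpos (div_nonpos_of_nonpos_of_nonneg ht (by positivity)),
          ENNReal.ofReal_of_nonpos ht]
        simp
    rw [this]; ring
  rw [lintegral_congr_ae hs, lintegral_const_mul' _ _ (by finiteness), rootLossRate,
    ENNReal.ofReal_mul (by positivity), ENNReal.ofReal_mul hlam.le, ENNReal.ofReal_toReal hσ.moment]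
  ring

lemma map_rootLoss_apIntensity {lam : ℝ} (hlam : 0 < lam) {σ : Measure ℝ}
    (hσ : IsShadowingLaw σ) :
    (apIntensity lam σ).map (fun p => rootLoss (pathLoss p.1 p.2)) =
      ENNReal.ofReal (rootLossRate lam σ) • volume.restrict (Ioi 0) := by
  have hm : Measurable (fun p : Plane × ℝ => rootLoss (pathLoss p.1 p.2)) :=
    measurable_rootLoss.comp measurable_pathLoss
  have h1 (t : ℝ) : (apIntensity lam σ).map (fun p => rootLoss (pathLoss p.1 p.2)) (Iio t) =
      ENNReal.ofReal (rootLossRate lam σ) * ENNReal.ofReal t := by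
    rw [Measure.map_apply hm measurableSet_Iio]
    exact apIntensity_rootLoss_lt hlam hσ t
  have h2 (t : ℝ) : (ENNReal.ofReal (rootLossRate lam σ) • volume.restrict (Ioi (0 : ℝ))) (Iio t) =
      ENNReal.ofReal (rootLossRate lam σ) * ENNReal.ofReal t := by
    rw [Measure.smul_apply, Measure.restrict_apply measurableSet_Iio, Iio_inter_Ioi,
      Real.volume_Ioo, sub_zero, smul_eq_mul]
  refine Measure.ext_of_Ico' _ _ (fun a b _ => ?_) (fun a b hab => ?_)
  · refine ((measure_mono Ico_subset_Iio_self).trans_lt ?_).ne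
    rw [h1]
    finiteness
  · rw [← Iio_sdiff_Iio, measure_sdiff (Iio_subset_Iio hab.le) nullMeasurableSet_Iio
      (by rw [h1]; finiteness), measure_sdiff (Iio_subset_Iio hab.le) nullMeasurableSet_Iio
      (by rw [h2]; finiteness), h1, h1, h2, h2]

/-! ### Serving path loss -/

section Serving

variable {Ω : Type*} {Φ : Ω → Set (Plane × ℝ)}

/-- Events about the minimum become void events; the strict inequality avoids asking whether the
infimum is attained. -/
lemma le_servingPathLoss_iff (u : ℝ≥0∞) (ω : Ω) :
    u ≤ servingPathLoss Φ ω ↔ pointCount Φ {p | pathLoss p.1 p.2 < u} ω = 0 := by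
  simp only [servingPathLoss, le_iInf_iff, pointCount, encard_eq_zero, eq_empty_iff_forall_notMem,
    mem_inter_iff, mem_ofPred_eq, not_and, not_lt]

variable [MeasurableSpace Ω] {P : Measure Ω}

lemma IsPPP.measurable_servingPathLoss {Λ : Measure (Plane × ℝ)} (h : IsPPP P Φ Λ) :
    Measurable (servingPathLoss Φ) := by
  refine measurable_of_Ici fun u => ?_
  have : servingPathLoss Φ ⁻¹' Ici u = pointCount Φ {p | pathLoss p.1 p.2 < u} ⁻¹' {0} := by
    ext ω; exact le_servingPathLoss_iff u ω
  rw [this]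
  exact h.measurable_count _ (measurableSet_lt measurable_pathLoss measurable_const)
    (measurableSet_singleton _)

lemma IsPPP.le_servingPathLoss {lam : ℝ} (hlam : 0 < lam) {σ : Measure ℝ} (hσ : IsShadowingLaw σ)
    (h : IsPPP P Φ (apIntensity lam σ)) {t : ℝ} (ht : 0 < t) :
    P {ω | ENNReal.ofReal (t ^ 2) ≤ servingPathLoss Φ ω} =
      ENNReal.ofReal (Real.exp (-(rootLossRate lam σ * t))) := by
  have hκ := rootLossRate_pos hlam hσ
  have hB : {p : Plane × ℝ | pathLoss p.1 p.2 < ENNReal.ofReal (t ^ 2)} =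
      {p | rootLoss (pathLoss p.1 p.2) < t} := by
    ext p
    simp only [mem_ofPred_eq]
    rw [ENNReal.lt_ofReal_iff_toReal_lt (pathLoss_ne_top _ _), rootLoss, Real.sqrt_lt' ht]
  have hΛ : apIntensity lam σ {p : Plane × ℝ | pathLoss p.1 p.2 < ENNReal.ofReal (t ^ 2)} =
      ENNReal.ofReal (rootLossRate lam σ * t) := by
    rw [hB, apIntensity_rootLoss_lt hlam hσ, ENNReal.ofReal_mul hκ.le]
  have h0 := h.poisson {p | pathLoss p.1 p.2 < ENNReal.ofReal (t ^ 2)}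
    (measurableSet_lt measurable_pathLoss measurable_const)
    (by rw [hΛ]; exact ENNReal.ofReal_ne_top) 0
  simp_rw [le_servingPathLoss_iff]
  rw [hΛ, ENNReal.toReal_ofReal (by positivity)] at h0
  simpa using h0

lemma IsPPP.servingPathLoss_ne_top {lam : ℝ} (hlam : 0 < lam) {σ : Measure ℝ}
    (hσ : IsShadowingLaw σ) (h : IsPPP P Φ (apIntensity lam σ)) :
    ∀ᵐ ω ∂P, servingPathLoss Φ ω ≠ ∞ := by
  have hκ := rootLossRate_pos hlam hσ
  rw [ae_iff]
  simp only [not_not]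
  refine le_antisymm ?_ zero_le
  have hlim : Tendsto (fun t : ℝ => ENNReal.ofReal (Real.exp (-(rootLossRate lam σ * t)))) atTop
      (𝓝 0) := by
    rw [← ENNReal.ofReal_zero]
    exact (ENNReal.continuous_ofReal.tendsto _).comp (Real.tendsto_exp_neg_atTop_nhds_zero.comp
      (tendsto_id.const_mul_atTop hκ))
  refine ge_of_tendsto hlim ?_
  filter_upwards [eventually_gt_atTop 0] with t ht
  rw [← h.le_servingPathLoss hlam hσ ht]
  exact measure_mono fun ω hω => by simp only [mem_ofPred_eq] at hω ⊢; rw [hω]; exact le_top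

/-- The first point of a rate `κ` Poisson process on the half-line is exponential. Almost sure
finiteness is needed because `rootLoss ∞ = 0`. -/
lemma IsPPP.map_rootLoss_servingPathLoss [IsProbabilityMeasure P] {lam : ℝ} (hlam : 0 < lam)
    {σ : Measure ℝ} (hσ : IsShadowingLaw σ) (h : IsPPP P Φ (apIntensity lam σ)) :
    (P.map (servingPathLoss Φ)).map rootLoss = expMeasure (rootLossRate lam σ) := by
  have hκ := rootLossRate_pos hlam hσ
  have := isProbabilityMeasure_expMeasure hκ
  have hm := h.measurable_servingPathLoss
  have hprob : IsProbabilityMeasure (P.map (servingPathLoss Φ)) :=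
    Measure.isProbabilityMeasure_map hm.aemeasurable
  have hprob' : IsProbabilityMeasure ((P.map (servingPathLoss Φ)).map rootLoss) :=
    Measure.isProbabilityMeasure_map measurable_rootLoss.aemeasurable
  have key (t : ℝ) (ht : 0 < t) : (P.map (servingPathLoss Φ)).map rootLoss (Ici t) =
      expMeasure (rootLossRate lam σ) (Ici t) := by
    rw [expMeasure_Ici hκ ht.le, Measure.map_apply measurable_rootLoss measurableSet_Ici,
      Measure.map_apply hm (measurable_rootLoss measurableSet_Ici),
      ← h.le_servingPathLoss hlam hσ ht]
    refine measure_congr ?_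
    filter_upwards [h.servingPathLoss_ne_top hlam hσ] with ω hω
    refine propext ?_
    change t ≤ rootLoss (servingPathLoss Φ ω) ↔ ENNReal.ofReal (t ^ 2) ≤ servingPathLoss Φ ω
    rw [ENNReal.ofReal_le_iff_le_toReal hω, rootLoss, Real.le_sqrt' ht]
  refine Measure.ext_of_Ici _ _ fun t => ?_
  rcases lt_or_ge 0 t with ht | ht
  · exact key t ht
  · have h2 : ∀ᵐ x ∂expMeasure (rootLossRate lam σ), x ∈ Ici t := by
      filter_upwards [ae_pos_expMeasure hκ] with x hx using ht.trans hx.le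
    have h1 : rootLoss ⁻¹' Ici t = univ :=
      eq_univ_of_forall fun l => ht.trans (Real.sqrt_nonneg _)
    rw [(mem_ae_iff_prob_eq_one measurableSet_Ici).1 h2,
      Measure.map_apply measurable_rootLoss measurableSet_Ici, h1, measure_univ]

end Serving

/-! ### Mean effect of the interferers -/

lemma funC_nonneg (x : ℝ) : 0 ≤ funC x :=
  mul_nonneg (Real.sqrt_nonneg _) (Real.arctan_nonneg.2 (Real.sqrt_nonneg _))

/-- Mean effect `∫ (1 - exp (-T V ^ 2 h / W ^ 2)) e ^ (-h) dh` of the fading of an interferer with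
root serving path loss `V` and root path loss `W` to the typical serving access point. -/
noncomputable def interfererEffect (T V W : ℝ) : ℝ≥0∞ :=
  if V ≤ W then ENNReal.ofReal (T * V ^ 2 / (W ^ 2 + T * V ^ 2)) else 0

lemma measurable_interfererEffect (T : ℝ) :
    Measurable (fun p : ℝ × ℝ => interfererEffect T p.1 p.2) :=
  Measurable.ite (measurableSet_le measurable_fst measurable_snd) (by fun_prop) measurable_const

lemma lintegral_interfererEffect {T V : ℝ} (hT : 0 < T) (hV : 0 < V) :
    ∫⁻ W in Ioi 0, interfererEffect T V W = ENNReal.ofReal (funC T) * ENNReal.ofReal V := by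
  have h1 : ∫⁻ W in Ioi 0, interfererEffect T V W =
      ∫⁻ W in Ioi V, ENNReal.ofReal (T * V ^ 2 / (W ^ 2 + T * V ^ 2)) := by
    rw [setLIntegral_congr (Ioi_ae_eq_Ici (a := V)), ← lintegral_indicator measurableSet_Ioi,
      ← lintegral_indicator measurableSet_Ici]
    refine lintegral_congr fun W => ?_
    by_cases hW : V ≤ W
    · simp [interfererEffect, hW, hV.trans_le hW]
    · simp [interfererEffect, hW]
  -- With this scale the integrand is `a² / (W² + a²)`, with primitive `a * arctan (W / a)`.
  set a := √T * V with ha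
  have ha0 : 0 < a := mul_pos (Real.sqrt_pos.2 hT) hV
  have ha2 : T * V ^ 2 = a ^ 2 := by rw [ha, mul_pow, Real.sq_sqrt hT.le]
  have hderiv : ∀ W ∈ Ici V, HasDerivAt (fun W => a * Real.arctan (W / a))
      (T * V ^ 2 / (W ^ 2 + T * V ^ 2)) W := by
    intro W _
    have := (((hasDerivAt_id W).div_const a).arctan).const_mul a
    convert! this using 1
    rw [ha2]
    simp only [id]
    field_simp
    ring
  have hnonneg : ∀ W ∈ Ioi V, 0 ≤ T * V ^ 2 / (W ^ 2 + T * V ^ 2) := fun W _ => by positivity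
  have hlim : Tendsto (fun W => a * Real.arctan (W / a)) atTop (𝓝 (a * (Real.pi / 2))) :=
    (((Real.tendsto_arctan_atTop.mono_right nhdsWithin_le_nhds).comp
      (tendsto_id.atTop_div_const ha0))).const_mul a
  rw [h1, ← ofReal_integral_eq_lintegral_ofReal
    (integrableOn_Ioi_deriv_of_nonneg' hderiv hnonneg hlim)
    ((ae_restrict_iff' measurableSet_Ioi).2 (ae_of_all _ hnonneg)),
    integral_Ioi_of_hasDerivAt_of_nonneg' hderiv hnonneg hlim, ← ENNReal.ofReal_mul
      (funC_nonneg T)]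
  congr 1
  -- The lower limit contributes `arctan (1 / √T) = π / 2 - arctan √T`, leaving `√T * V * arctan
  -- √T`.
  have h2 : V / a = (√T)⁻¹ := by rw [ha]; field_simp
  rw [h2, Real.arctan_inv_of_pos (Real.sqrt_pos.2 hT), funC, ha]
  ring

/-- Contribution of an interferer to the interference. -/
noncomputable def received (p : Interferer) : ℝ≥0∞ :=
  p.ownLoss * ENNReal.ofReal p.fading / p.crossLoss

lemma measurable_ownLoss : Measurable Interferer.ownLoss := by
  unfold Interferer.ownLoss; fun_prop

lemma measurable_fading : Measurable Interferer.fading := by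
  unfold Interferer.fading; fun_prop

lemma measurable_crossLoss : Measurable Interferer.crossLoss :=
  measurable_pathLoss.comp (by unfold Interferer.pos Interferer.shadow; fun_prop :
    Measurable fun p : Interferer => (p.pos, p.shadow))

lemma measurable_received : Measurable received :=
  (measurable_ownLoss.mul measurable_fading.ennreal_ofReal).div measurable_crossLoss

lemma lintegral_fading {T : ℝ} (hT : 0 < T) {l c : ℝ≥0∞} (hl : 0 < rootLoss l)
    (hc : 0 < rootLoss c) :
    ∫⁻ h, (if l ≤ c then 1 - negExp (ENNReal.ofReal T * (l * ENNReal.ofReal h / c)) else 0)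
      ∂expMeasure 1 = interfererEffect T (rootLoss l) (rootLoss c) := by
  by_cases hlc : l ≤ c
  · simp only [hlc, if_true]
    rw [interfererEffect, if_pos ((le_iff_rootLoss_le hl hc).1 hlc)]
    set V := rootLoss l
    set W := rootLoss c
    have he : ∀ h : ℝ, ENNReal.ofReal T * (l * ENNReal.ofReal h / c) =
        ENNReal.ofReal (T * V ^ 2 / W ^ 2 * h) := by
      intro h
      rw [eq_ofReal_rootLoss_sq hl, eq_ofReal_rootLoss_sq hc, ← ENNReal.ofReal_mul (by positivity),
        ← ENNReal.ofReal_div_of_pos (by positivity), ← ENNReal.ofReal_mul hT.le]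
      congr 1
      ring
    simp_rw [he]
    rw [lintegral_one_sub_negExp_expMeasure (by positivity)]
    congr 1
    field_simp
  · simp only [hlc, if_false, lintegral_zero]
    rw [interfererEffect, if_neg (fun h => hlc ((le_iff_rootLoss_le hl hc).2 h))]

/-- Density cancels here: the intensity in `W` contributes `κ`, the mean of `V` contributes `κ⁻¹`.
Only the law of the root of the serving loss matters. -/
lemma lintegral_interfererIntensity {lam : ℝ} (hlam : 0 < lam) {σ : Measure ℝ}
    (hσ : IsShadowingLaw σ) {ρ : Measure ℝ≥0∞} [IsProbabilityMeasure ρ]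
    (hρ : ρ.map rootLoss = expMeasure (rootLossRate lam σ)) {T : ℝ} (hT : 0 < T) :
    ∫⁻ p, (1 - negExp (ENNReal.ofReal T * received p)) ∂interfererIntensity lam σ ρ =
      ENNReal.ofReal (funC T) := by
  have := hσ.prob
  have hκ := rootLossRate_pos hlam hσ
  set κ := rootLossRate lam σ with hκdef
  have := isProbabilityMeasure_expMeasure hκ
  have := isProbabilityMeasure_expMeasure one_pos
  have hA : MeasurableSet {p : Interferer | p.ownLoss ≤ p.crossLoss} :=
    measurableSet_le measurable_ownLoss measurable_crossLoss
  set F : Interferer → ℝ≥0∞ := {p : Interferer | p.ownLoss ≤ p.crossLoss}.indicator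
    (fun p => 1 - negExp (ENNReal.ofReal T * received p)) with hF
  have hFm : Measurable F :=
    ((measurable_negExp.comp (measurable_received.const_mul _)).const_sub 1).indicator hA
  have hl0 : ∀ᵐ l ∂ρ, 0 < rootLoss l := by
    refine ae_of_ae_map measurable_rootLoss.aemeasurable ?_
    rw [hρ]
    exact ae_pos_expMeasure hκ
  have hWm : Measurable (fun p : Plane × ℝ => rootLoss (pathLoss p.1 p.2)) :=
    measurable_rootLoss.comp measurable_pathLoss
  have hc0 : ∀ᵐ p ∂apIntensity lam σ, 0 < rootLoss (pathLoss p.1 p.2) := by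
    refine ae_of_ae_map (p := fun x => 0 < x) hWm.aemeasurable ?_
    rw [map_rootLoss_apIntensity hlam hσ]
    exact Measure.ae_smul_measure (ae_restrict_mem measurableSet_Ioi) _
  have hGm := measurable_interfererEffect T
  have hinner : ∀ᵐ p ∂apIntensity lam σ, ∫⁻ l, ∫⁻ h, F (p.1, p.2, l, h) ∂expMeasure 1 ∂ρ =
      ∫⁻ V, interfererEffect T V (rootLoss (pathLoss p.1 p.2)) ∂expMeasure κ := by
    filter_upwards [hc0] with p hp
    have hV : Measurable fun V : ℝ => interfererEffect T V (rootLoss (pathLoss p.1 p.2)) :=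
      hGm.comp (by fun_prop : Measurable fun V : ℝ => (V, rootLoss (pathLoss p.1 p.2)))
    rw [← hρ, lintegral_map hV measurable_rootLoss]
    refine lintegral_congr_ae ?_
    filter_upwards [hl0] with l hl
    rw [← lintegral_fading hT hl hp]
    refine lintegral_congr fun h => ?_
    rw [hF, indicator_apply]
    exact if_congr Iff.rfl rfl rfl
  calc ∫⁻ p, (1 - negExp (ENNReal.ofReal T * received p)) ∂interfererIntensity lam σ ρ
      = ∫⁻ p, F p ∂((ENNReal.ofReal lam • (volume : Measure Plane)).prod
          (σ.prod (ρ.prod (expMeasure 1)))) := by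
        rw [interfererIntensity, hF, lintegral_indicator hA]
    _ = ∫⁻ x, ∫⁻ s, ∫⁻ l, ∫⁻ h, F (x, s, l, h) ∂expMeasure 1 ∂ρ ∂σ
          ∂(ENNReal.ofReal lam • (volume : Measure Plane)) := by
        rw [lintegral_prod _ hFm.aemeasurable]
        refine lintegral_congr fun x => ?_
        have hx : Measurable fun y => F (x, y) := hFm.comp (by fun_prop)
        rw [lintegral_prod _ hx.aemeasurable]
        refine lintegral_congr fun s => ?_
        have hs : Measurable fun y => F (x, s, y) := hFm.comp (by fun_prop)
        rw [lintegral_prod _ hs.aemeasurable]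
    _ = ∫⁻ p, ∫⁻ l, ∫⁻ h, F (p.1, p.2, l, h) ∂expMeasure 1 ∂ρ ∂apIntensity lam σ := by
        rw [lintegral_prod]
        have h1 : Measurable fun q : ((Plane × ℝ) × ℝ≥0∞) × ℝ => F (q.1.1.1, q.1.1.2, q.1.2, q.2) :=
          hFm.comp (by fun_prop)
        exact (Measurable.lintegral_prod_right' (f := fun q : (Plane × ℝ) × ℝ≥0∞ =>
          ∫⁻ h, F (q.1.1, q.1.2, q.2, h) ∂expMeasure 1)
          (Measurable.lintegral_prod_right' h1)).aemeasurable
    _ = ∫⁻ p, ∫⁻ V, interfererEffect T V (rootLoss (pathLoss p.1 p.2)) ∂expMeasure κ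
          ∂apIntensity lam σ := lintegral_congr_ae hinner
    _ = ∫⁻ W, ∫⁻ V, interfererEffect T V W ∂expMeasure κ
          ∂(ENNReal.ofReal κ • volume.restrict (Ioi 0)) := by
        rw [hκdef, ← map_rootLoss_apIntensity hlam hσ, lintegral_map _ hWm]
        exact Measurable.lintegral_prod_right' (f := fun q : ℝ × ℝ => interfererEffect T q.2 q.1)
          (hGm.comp measurable_swap)
    -- Tonelli: integrating over `W` first leaves a multiple of `V`.
    _ = ENNReal.ofReal κ * ∫⁻ V, (∫⁻ W in Ioi 0, interfererEffect T V W) ∂expMeasure κ := by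
        rw [lintegral_smul_measure, smul_eq_mul,
          lintegral_lintegral_swap (f := fun W V => interfererEffect T V W)
            (hGm.comp measurable_swap).aemeasurable]
    _ = ENNReal.ofReal κ * ∫⁻ V, ENNReal.ofReal (funC T) * ENNReal.ofReal V ∂expMeasure κ := by
        congr 1
        refine lintegral_congr_ae ?_
        filter_upwards [ae_pos_expMeasure hκ] with V hV using lintegral_interfererEffect hT hV
    _ = ENNReal.ofReal (funC T) := by
        rw [lintegral_const_mul' _ _ ENNReal.ofReal_ne_top, lintegral_id_expMeasure hκ,
          mul_left_comm, ← ENNReal.ofReal_mul hκ.le, mul_inv_cancel₀ hκ.ne', ENNReal.ofReal_one,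
          mul_one]

/-! ### Distribution of the SINR -/

lemma expMeasure_one_le_ofReal (y : ℝ≥0∞) :
    expMeasure 1 {h | y ≤ ENNReal.ofReal h} = negExp y := by
  induction y with
  | top => simp [negExp_top]
  | coe y =>
    have h1 : {h : ℝ | (y : ℝ≥0∞) ≤ ENNReal.ofReal h} =ᵐ[expMeasure 1] Ici (y : ℝ) := by
      filter_upwards [ae_pos_expMeasure one_pos] with h hh
      refine propext ?_
      change (y : ℝ≥0∞) ≤ ENNReal.ofReal h ↔ (y : ℝ) ≤ h
      rw [ENNReal.le_ofReal_iff_toReal_le ENNReal.coe_ne_top hh.le, ENNReal.coe_toReal]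
    rw [measure_congr h1, expMeasure_Ici one_pos y.coe_nonneg, ← ENNReal.ofReal_coe_nnreal,
      negExp_ofReal y.coe_nonneg, one_mul]

section Uplink

variable {Ω : Type*} [MeasurableSpace Ω] {P : Measure Ω} {lam : ℝ} {σ : Measure ℝ}
  {Φ : Ω → Set (Plane × ℝ)} {Ψ : Ω → Set Interferer} {H : Ω → ℝ}

lemma IsUplinkModel.measurable_interference (h : IsUplinkModel P lam σ Φ Ψ H) :
    Measurable (interference Ψ) :=
  (measurable_tsum_sigmaOf Ψ measurable_received).mono h.interferers.sigmaOf_le le_rfl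

lemma IsUplinkModel.measurable_sinr (h : IsUplinkModel P lam σ Φ Ψ H) (snrInv : ℝ≥0∞) :
    Measurable (sinr snrInv Ψ H) :=
  h.fading_measurable.ennreal_ofReal.div (h.measurable_interference.const_add _)

/-- Laplace transform of the interference. -/
lemma IsUplinkModel.lintegral_negExp_interference [IsProbabilityMeasure P] (hlam : 0 < lam)
    (hσ : IsShadowingLaw σ)
    (h : IsUplinkModel P lam σ Φ Ψ H) {T : ℝ} (hT : 0 < T) :
    ∫⁻ ω, negExp (ENNReal.ofReal T * interference Ψ ω) ∂P =
      ENNReal.ofReal (Real.exp (-funC T)) := by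
  have := hσ.prob
  have := isProbabilityMeasure_expMeasure one_pos
  have : IsProbabilityMeasure (P.map (servingPathLoss Φ)) :=
    Measure.isProbabilityMeasure_map h.aps.measurable_servingPathLoss.aemeasurable
  have : SigmaFinite (interfererIntensity lam σ (P.map (servingPathLoss Φ))) := by
    have : SigmaFinite (ENNReal.ofReal lam • (volume : Measure Plane)) :=
      inferInstanceAs (SigmaFinite (lam.toNNReal • (volume : Measure Plane)))
    unfold interfererIntensity; infer_instance
  have h1 (ω : Ω) : ENNReal.ofReal T * interference Ψ ω =
      ∑' p : Ψ ω, ENNReal.ofReal T * received p := ENNReal.tsum_mul_left.symm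
  simp_rw [h1]
  rw [h.interferers.lintegral_negExp_tsum (measurable_received.const_mul _),
    lintegral_interfererIntensity hlam hσ (h.aps.map_rootLoss_servingPathLoss hlam hσ) hT,
    negExp_ofReal (funC_nonneg T)]

/-- Coverage probability of the typical device. -/
theorem IsUplinkModel.measure_le_sinr [IsProbabilityMeasure P] (hlam : 0 < lam) (hσ : IsShadowingLaw σ)
    (h : IsUplinkModel P lam σ Φ Ψ H) {T : ℝ} (hT : 0 < T) :
    P {ω | ENNReal.ofReal T ≤ sinr 0 Ψ H ω} = ENNReal.ofReal (Real.exp (-funC T)) := by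
  have hI := h.measurable_interference
  have hind : IndepFun H (interference Ψ) P :=
    indep_of_indep_of_le_right h.fading_indep
      (measurable_iff_comap_le.1 (measurable_tsum_sigmaOf Ψ measurable_received))
  -- The equality is only almost sure: positive fading rules out `0 / 0 = 0` when the interference
  -- vanishes.
  have hset : {ω | ENNReal.ofReal T ≤ sinr 0 Ψ H ω} =ᵐ[P]
      {ω | ENNReal.ofReal T * interference Ψ ω ≤ ENNReal.ofReal (H ω)} := by
    have hH : ∀ᵐ ω ∂P, 0 < H ω := by
      refine ae_of_ae_map h.fading_measurable.aemeasurable ?_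
      rw [h.fading_law]
      exact ae_pos_expMeasure one_pos
    filter_upwards [hH] with ω hω
    refine propext ?_
    change ENNReal.ofReal T ≤ ENNReal.ofReal (H ω) / (0 + interference Ψ ω) ↔ _
    rw [zero_add]
    exact ENNReal.le_div_iff_mul_le (Or.inr (by simpa using hω)) (Or.inr ENNReal.ofReal_ne_top)
  have hS : MeasurableSet {p : ℝ × ℝ≥0∞ | ENNReal.ofReal T * p.2 ≤ ENNReal.ofReal p.1} :=
    measurableSet_le (by fun_prop) (by fun_prop)
  have : IsProbabilityMeasure (P.map (interference Ψ)) :=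
    Measure.isProbabilityMeasure_map hI.aemeasurable
  have := isProbabilityMeasure_expMeasure one_pos
  rw [measure_congr hset, show {ω | ENNReal.ofReal T * interference Ψ ω ≤ ENNReal.ofReal (H ω)} =
    (fun ω => (H ω, interference Ψ ω)) ⁻¹'
      {p : ℝ × ℝ≥0∞ | ENNReal.ofReal T * p.2 ≤ ENNReal.ofReal p.1} from rfl,
    ← Measure.map_apply (h.fading_measurable.prodMk hI) hS, hind.map_prod_eq_prod_map_map
      h.fading_measurable.aemeasurable hI.aemeasurable, h.fading_law, Measure.prod_apply_symm hS,
    lintegral_map (measurable_measure_prodMk_right hS) hI,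
    ← h.lintegral_negExp_interference hlam hσ hT]
  -- Given the interference, the exponential tail of `H` at `T * I` is exactly `exp (-T I)`.
  exact lintegral_congr fun ω =>
    expMeasure_one_le_ofReal (ENNReal.ofReal T * interference Ψ ω)

end Uplink

/-! ### Delay and rate -/

lemma ofReal_le_log2OneAdd_iff (y : ℝ) (x : ℝ≥0∞) :
    ENNReal.ofReal y ≤ log2OneAdd x ↔ ENNReal.ofReal (funT y) ≤ x := by
  have hl2 : 0 < Real.log 2 := Real.log_pos one_lt_two
  have hl2' : 0 < ENNReal.ofReal (Real.log 2) := ENNReal.ofReal_pos.2 hl2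
  induction x with
  | top => simp [log2OneAdd, ENNReal.top_div_of_ne_top]
  | coe x =>
    have hx : 0 ≤ (x : ℝ) := x.2
    have hlog : 0 ≤ Real.log (1 + x) := Real.log_nonneg (by linarith)
    have h1 : log2OneAdd x = ENNReal.ofReal (Real.log (1 + x) / Real.log 2) := by
      rw [log2OneAdd, ← ENNReal.ofReal_coe_nnreal, ← ENNReal.ofReal_one,
        ← ENNReal.ofReal_add zero_le_one hx, ENNReal.log_ofReal_of_pos (by linarith),
        EReal.toENNReal_of_ne_top (EReal.coe_ne_top _), EReal.toReal_coe,
        ENNReal.ofReal_div_of_pos hl2]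
    rw [h1, ENNReal.ofReal_le_ofReal_iff (by positivity), ← ENNReal.ofReal_coe_nnreal,
      ENNReal.ofReal_le_ofReal_iff hx, le_div_iff₀ hl2,
      ← Real.log_rpow two_pos, Real.log_le_log_iff (by positivity) (by linarith), funT]
    constructor <;> intro h <;> linarith

/-- Equal rates merge the two halves into `q / Rate`, and `T` inverts `log₂ (1 + ·)`. The load
multiplies the required inference rate. -/
lemma delay_le_iff {q b δc δt load : ℝ} (hq : 0 < q) (hb : 0 < b) (hδc : 0 ≤ δc) (hδ : δc < δt)
    (hload : 0 < load) (x : ℝ≥0∞) :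
    delay q δc (rate b load x) (rate b load x) ≤ ENNReal.ofReal δt ↔
      ENNReal.ofReal (funT (load * inferenceRate q b δt δc)) ≤ x := by
  have hd : 0 < δt - δc := sub_pos.2 hδ
  have hr : 0 ≤ load * inferenceRate q b δt δc := by unfold inferenceRate; positivity
  rw [← ofReal_le_log2OneAdd_iff, delay]
  have h2 : ENNReal.ofReal q / (2 * rate b load x) = ENNReal.ofReal q / rate b load x / 2 := by
    rw [mul_comm, div_eq_mul_inv, div_eq_mul_inv, div_eq_mul_inv,
      ENNReal.mul_inv (Or.inr (by simp)) (Or.inr (by simp)), mul_assoc]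
  have h3 : ENNReal.ofReal δt = ENNReal.ofReal (δt - δc) + ENNReal.ofReal δc := by
    rw [← ENNReal.ofReal_add hd.le hδc, sub_add_cancel]
  -- The payload is factored so that `(δt - δc) * (b / load)` cancels against the rate.
  have h4 : ENNReal.ofReal q = ENNReal.ofReal ((δt - δc) * (b / load)) *
      ENNReal.ofReal (load * inferenceRate q b δt δc) := by
    rw [← ENNReal.ofReal_mul (by positivity), inferenceRate]
    congr 1
    field_simp
  rw [h2, ENNReal.add_halves, h3, ENNReal.add_le_add_iff_right ENNReal.ofReal_ne_top,
    ENNReal.div_le_iff_le_mul (Or.inr ENNReal.ofReal_ne_top) (Or.inr (by simpa using hδ)), rate,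
    ← mul_assoc, ← ENNReal.ofReal_mul hd.le, h4]
  exact ENNReal.mul_le_mul_iff_right (by simpa using (by positivity : 0 < (δt - δc) * (b / load)))
    ENNReal.ofReal_ne_top

/-! ### Monotonicity and limits of `T` and `C` -/

lemma funT_pos {r : ℝ} (hr : 0 < r) : 0 < funT r :=
  sub_pos.2 (Real.one_lt_rpow one_lt_two hr)

lemma strictMono_funT : StrictMono funT := fun _ _ h =>
  sub_lt_sub_right (Real.rpow_lt_rpow_of_exponent_lt one_lt_two h) 1

lemma continuous_funT : Continuous funT := by
  unfold funT
  exact (Real.continuous_const_rpow two_ne_zero).sub continuous_const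

lemma continuous_funC : Continuous funC := by
  unfold funC
  exact Real.continuous_sqrt.mul (Real.continuous_arctan.comp Real.continuous_sqrt)

lemma strictMonoOn_funC : StrictMonoOn funC (Ici 0) := by
  intro x hx y _ hxy
  have h1 : √x < √y := Real.sqrt_lt_sqrt hx hxy
  exact mul_lt_mul'' h1 (Real.arctan_strictMono h1) (Real.sqrt_nonneg _)
    (Real.arctan_nonneg.2 (Real.sqrt_nonneg _))

lemma tendsto_funC_atTop : Tendsto funC atTop atTop :=
  Real.tendsto_sqrt_atTop.atTop_mul_pos (C := Real.pi / 2) (by positivity)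
    ((Real.tendsto_arctan_atTop.mono_right nhdsWithin_le_nhds).comp Real.tendsto_sqrt_atTop)

lemma tendsto_funT_atTop : Tendsto funT atTop atTop :=
  tendsto_atTop_add_const_right _ _ (tendsto_rpow_atTop_of_base_gt_one 2 one_lt_two)

/-! ### Average MSE at fixed density and its limit -/

/-- Average MSE of distributed inference over a noiseless network of any density. -/
theorem IsUplinkModel.averageMSE_eq {Ω : Type*} [MeasurableSpace Ω] {P : Measure Ω}
    [IsProbabilityMeasure P] {lam : ℝ} {σ : Measure ℝ} {Φ : Ω → Set (Plane × ℝ)}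
    {Ψ : Ω → Set Interferer} {H : Ω → ℝ} (hlam : 0 < lam) (hσ : IsShadowingLaw σ)
    (h : IsUplinkModel P lam σ Φ Ψ H) {q b δc δt load : ℝ} (hq : 0 < q) (hb : 0 < b)
    (hδc : 0 ≤ δc) (hδ : δc < δt) (hload : 0 < load) (mc md : ℝ) :
    averageMSE P (cloudDelay 0 q b δc load Ψ H) δt mc md =
      md - (md - mc) * Real.exp (-funC (funT (load * inferenceRate q b δt δc))) := by
  have hr : 0 < load * inferenceRate q b δt δc := by
    have : 0 < δt - δc := sub_pos.2 hδ
    unfold inferenceRate; positivity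
  set A := {ω | ENNReal.ofReal (funT (load * inferenceRate q b δt δc)) ≤ sinr 0 Ψ H ω} with hA
  have hAm : MeasurableSet A := measurableSet_le measurable_const (h.measurable_sinr 0)
  have h1 : {ω | cloudDelay 0 q b δc load Ψ H ω ≤ ENNReal.ofReal δt} = A := by
    ext ω; exact delay_le_iff hq hb hδc hδ hload _
  have h2 : {ω | ENNReal.ofReal δt < cloudDelay 0 q b δc load Ψ H ω} = Aᶜ := by
    rw [← h1]; ext ω; simp
  have hP : P.real A = Real.exp (-funC (funT (load * inferenceRate q b δt δc))) := by
    rw [measureReal_def, h.measure_le_sinr hlam hσ (funT_pos hr),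
      ENNReal.toReal_ofReal (Real.exp_nonneg _)]
  rw [averageMSE, h1, h2, integral_indicator_const _ hAm, integral_indicator_const _ hAm.compl,
    probReal_compl_eq_one_sub hAm, hP, smul_eq_mul, smul_eq_mul]
  ring

lemma one_lt_averageLoad {lamU lam : ℝ} (hU : 0 < lamU) (hlam : 0 < lam) :
    1 < averageLoad lamU lam :=
  lt_add_of_pos_right 1 (by positivity)

lemma tendsto_averageLoad {lamU : ℝ} (hU : 0 < lamU) :
    Tendsto (fun lam => averageLoad lamU lam) atTop (𝓝 1) := by
  have := ((tendsto_id (α := ℝ)).atTop_div_const hU).const_div_atTop (1.28 : ℝ)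
  simpa [averageLoad] using this.const_add 1

lemma strictAntiOn_exp_neg_funC_funT :
    StrictAntiOn (fun r => Real.exp (-funC (funT r))) (Ioi 0) := fun _ hx _ hy hxy =>
  Real.exp_lt_exp.2 (neg_lt_neg (strictMonoOn_funC (funT_pos hx).le (funT_pos hy).le
    (strictMono_funT hxy)))

lemma continuous_exp_neg_funC_funT : Continuous (fun r => Real.exp (-funC (funT r))) :=
  Real.continuous_exp.comp (continuous_funC.comp continuous_funT).neg

end DistInf

theorem corollary1
    -- the network, for every AP density `lam`; thermal noise is neglected (`1 / SNR = 0`)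
    {Ω : ℝ → Type*} [∀ lam, MeasurableSpace (Ω lam)]
    (P : ∀ lam, Measure (Ω lam)) [∀ lam, IsProbabilityMeasure (P lam)]
    (σ : Measure ℝ) (hσ : DistInf.IsShadowingLaw σ)
    (Φ : ∀ lam, Ω lam → Set (DistInf.Plane × ℝ))
    (Ψ : ∀ lam, Ω lam → Set DistInf.Interferer)
    (H : ∀ lam, Ω lam → ℝ)
    (hmodel : ∀ lam, 0 < lam → DistInf.IsUplinkModel (P lam) lam σ (Φ lam) (Ψ lam) (H lam))
    (lamU : ℝ) (hlamU : 0 < lamU)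
    -- the data distribution, the true output, the edge output and the cloud output
    {𝒳 : Type*} [MeasurableSpace 𝒳] (ν : Measure 𝒳) [IsProbabilityMeasure ν]
    (Y Yd Yc : 𝒳 → ℝ)
    (hd : MemLp (fun x => Y x - Yd x) 2 ν) (hc : MemLp (fun x => Y x - Yc x) 2 ν)
    (md mc : ℝ) (hmd : md = DistInf.mse ν Y Yd) (hmc : mc = DistInf.mse ν Y Yc)
    (hle : mc ≤ md) :
    -- the mean load tends to one
    Tendsto (fun lam => DistInf.averageLoad lamU lam) atTop (𝓝 1) ∧
    ∃ mAsy : ℝ → ℝ,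
      (∀ q b δc δt : ℝ, 0 < q → 0 < b → 0 ≤ δc → δc < δt →
        -- `mAsy r_min` is the limit of the average MSE
        Tendsto
          (fun lam => DistInf.averageMSE (P lam)
            (DistInf.cloudDelay 0 q b δc (DistInf.averageLoad lamU lam) (Ψ lam) (H lam)) δt mc md)
          atTop (𝓝 (mAsy (DistInf.inferenceRate q b δt δc))) ∧
        -- the gain over the edge model is limited by the inference rate, at every AP density
        (∀ lam, 0 < lam →
          md - DistInf.averageMSE (P lam)
            (DistInf.cloudDelay 0 q b δc (DistInf.averageLoad lamU lam) (Ψ lam) (H lam)) δt mc md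
          ≤ (md - mc) *
            Real.exp (-DistInf.funC (DistInf.funT (DistInf.inferenceRate q b δt δc)))) ∧
        -- a larger bandwidth reduces the asymptotic MSE
        (mc < md →
          StrictAntiOn (fun b' => mAsy (DistInf.inferenceRate q b' δt δc)) (Ioi 0))) ∧
      (∀ r, 0 < r → mAsy r = md - (md - mc) * Real.exp (-DistInf.funC (DistInf.funT r))) ∧
      (mc < md → StrictMonoOn mAsy (Ioi 0)) ∧
      Tendsto mAsy atTop (𝓝 md) ∧
      Tendsto mAsy (𝓝[>] 0) (𝓝 mc) := by
  have hmono : mc < md → StrictMonoOn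
      (fun r => md - (md - mc) * Real.exp (-DistInf.funC (DistInf.funT r))) (Ioi 0) :=
    fun hlt x hx y hy hxy => sub_lt_sub_left
      (mul_lt_mul_of_pos_left (DistInf.strictAntiOn_exp_neg_funC_funT hx hy hxy)
        (sub_pos.2 hlt)) md
  refine ⟨DistInf.tendsto_averageLoad hlamU,
    fun r => md - (md - mc) * Real.exp (-DistInf.funC (DistInf.funT r)),
    fun q b δc δt hq hb hδc hδ => ?_, fun _ _ => rfl, hmono, ?_, ?_⟩
  · have hd : 0 < δt - δc := sub_pos.2 hδ
    have hr (b' : ℝ) (hb' : 0 < b') : 0 < DistInf.inferenceRate q b' δt δc := by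
      unfold DistInf.inferenceRate; positivity
    have hav (lam : ℝ) (hlam : 0 < lam) := (hmodel lam hlam).averageMSE_eq hlam hσ hq hb hδc hδ
      (one_pos.trans (DistInf.one_lt_averageLoad hlamU hlam)) mc md
    refine ⟨?_, fun lam hlam => ?_, fun hlt b₁ hb₁ b₂ hb₂ hbb => ?_⟩
    · have h1 : Tendsto (fun lam => DistInf.averageLoad lamU lam *
          DistInf.inferenceRate q b δt δc) atTop (𝓝 (DistInf.inferenceRate q b δt δc)) := by
        simpa using (DistInf.tendsto_averageLoad hlamU).mul_const (DistInf.inferenceRate q b δt δc)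
      -- Density acts only through the load, so continuity in the effective rate suffices.
      have h2 := (((DistInf.continuous_exp_neg_funC_funT.tendsto _).comp h1).const_mul
        (md - mc)).const_sub md
      refine h2.congr' ?_
      filter_upwards [eventually_gt_atTop 0] with lam hlam
      exact (hav lam hlam).symm
    · rw [hav lam hlam, sub_sub_cancel]
      refine mul_le_mul_of_nonneg_left ?_ (sub_nonneg.2 hle)
      -- A load above 1 raises the SINR threshold, so the cloud succeeds less often than in the
      -- limit.
      have hlt : DistInf.inferenceRate q b δt δc <
          DistInf.averageLoad lamU lam * DistInf.inferenceRate q b δt δc :=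
        lt_mul_of_one_lt_left (hr b hb) (DistInf.one_lt_averageLoad hlamU hlam)
      exact (DistInf.strictAntiOn_exp_neg_funC_funT (hr b hb) ((hr b hb).trans hlt) hlt).le
    · refine hmono hlt (hr b₂ hb₂) (hr b₁ hb₁) ?_
      exact div_lt_div_of_pos_left hq (mul_pos hb₁ hd) (mul_lt_mul_of_pos_right hbb hd)
  · have h1 : Tendsto (fun r => Real.exp (-DistInf.funC (DistInf.funT r))) atTop (𝓝 0) :=
      Real.tendsto_exp_neg_atTop_nhds_zero.comp
        (DistInf.tendsto_funC_atTop.comp DistInf.tendsto_funT_atTop)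
    simpa using (h1.const_mul (md - mc)).const_sub md
  · have h1 := (DistInf.continuous_exp_neg_funC_funT.tendsto 0).mono_left
      (nhdsWithin_le_nhds (s := Ioi 0))
    -- At `r = 0` both `T` and `C` vanish, so the value is `md - (md - mc) = mc`.
    simpa [DistInf.funT, DistInf.funC] using (h1.const_mul (md - mc)).const_sub md
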